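/- Let $T\in\mathbb C^{d_1}\otimes\cdots\otimes\mathbb C^{d_k}$ be a nonzero tensor. For each $i$ let $T_i:\mathbb C^{d_i}\to\bigotimes_{j\ne i}\mathbb C^{d_j}$ be its $i$-th flattening, let $\mu_i(T)=T_i^*T_i/\operatorname{Tr}(T_i^*T_i)$ be its $i$-th one-body marginal, and let $\operatorname{spec}_i(T)$ be the non-increasingly ordered sequence of eigenvalues of $\mu_i(T)$ with multiplicity, continued by zeros to an infinite sequence. Let $$\langle c\rangle_k=\sum_{j=1}^{c}e_j^{\otimes k}\in(\mathbb C^c)^{\otimes k}$$ be the (unnormalized) GHZ state with $c$ levels on $k$ parties, and let $$\mathsf M_n^k=\sum_{i\in[n]^k}\bigotimes_{\ell=1}^k e_{i_\ell,i_{\ell+1}}\in(\mathbb C^{n}\otimes\mathbb C^n)^{\otimes k}\qquad(i_{k+1}=i_1)$$ be the iterated matrix multiplication tensor (a maximally entangled pair of $n$-level systems on every edge of the $k$-cycle). A matrix product state of bond dimension $n$ with periodic boundary conditions (a PEPS on the $k$-cycle) is a tensor of the form $(A_1\otimes\cdots\otimes A_k)\,\mathsf M_n^k$ with arbitrary linear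 maps $A_i:\mathbb C^n\otimes\mathbb C^n\to\mathbb C^{d_i}$, for any local dimensions $d_1,\dots,d_k$. Let $k\ge 3$ and let $n,c\in\mathbb N$ satisfy $n^2-n+1<c\le n^2$. Then there are sequences $p_1,\dots,p_k\in\mathbb R^{\mathbb N}$ such that 1. there are local dimensions $d_i$ and linear maps $A_i:\mathbb C^c\to\mathbb C^{d_i}$ with $S=(A_1\otimes\cdots\otimes A_k)\langle c\rangle_k\neq 0$ and $\operatorname{spec}_i(S)=p_i$ for all $i=1,\dots,k$; 2. there is $\varepsilon>0$ such that for all local dimensions $d_1,\dots,d_k$ and every nonzero matrix product state $T\in\mathbb C^{d_1}\otimes\cdots\otimes\mathbb C^{d_k}$ of bond dimension $n$ with periodic boundary conditions, some $i\in\{1,\dots,k\}$ and some $m\in\mathbb N$ satisfy $|\operatorname{spec}_i(T)_m-p_{i,m}|\ge\varepsilon$. -/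

import Mathlib

open scoped Matrix

namespace TensorNetwork

/-- Order-`k` tensors in `⨂ i, ℂ^(ι i)`, given by their coordinates in the product basis
(`ι i` is the finite index set of the standard basis of the `i`-th factor). -/
abbrev Tensor {k : ℕ} (ι : Fin k → Type) : Type := (∀ i, ι i) → ℂ

/-- The product tensor `v 0 ⊗ v 1 ⊗ ⋯ ⊗ v (k-1)`. -/
def productTensor {k : ℕ} {ι : Fin k → Type} (v : ∀ i, ι i → ℂ) : Tensor ι :=
  fun x => ∏ i, v i (x i)

/-- The unnormalised GHZ state with `c` levels shared by `k` parties, that is, the unit tensor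
`∑ j, e_j ⊗ ⋯ ⊗ e_j` in `(ℂ^c)^{⊗ k}`. -/
def ghz (c k : ℕ) : Tensor (fun _ : Fin k => Fin c) :=
  ∑ j : Fin c, productTensor (fun _ => Pi.single j 1)

/-- The iterated matrix multiplication tensor
`∑ i : [k] → [n], ⨂ ℓ, e_{i ℓ, i (ℓ + 1)}` in `(ℂ^n ⊗ ℂ^n)^{⊗ k}`, with `ℓ + 1` taken cyclically
(`finRotate`). It is the (unnormalised) state in which every edge of the `k`-cycle carries a
maximally entangled pair of `n`-level systems. -/
def imm (n k : ℕ) : Tensor (fun _ : Fin k => Fin n × Fin n) :=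
  ∑ i : Fin k → Fin n, productTensor (fun l => Pi.single (i l, i (finRotate k l)) 1)

section

variable {k : ℕ} {ι κ : Fin k → Type}

/-- `(A 0 ⊗ ⋯ ⊗ A (k-1)) T`: a (not necessarily invertible) linear map is applied on each
factor. -/
def applyLocal [∀ i, Fintype (ι i)] (A : ∀ i, Matrix (κ i) (ι i) ℂ) (T : Tensor ι) : Tensor κ :=
  fun y => ∑ x, (∏ i, A i (y i) (x i)) * T x

/-- The `i`-th flattening of `T`: the matrix of the linear map from the `i`-th factor to the tensor
product of all the other ones. -/
def flattening (T : Tensor ι) (i : Fin k) : Matrix (∀ j : {j // j ≠ i}, ι j) (ι i) ℂ :=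
  Matrix.of fun r a => T ((Equiv.piSplitAt i ι).symm (a, r))

variable [∀ i, Fintype (ι i)]

/-- The one-body marginal (reduced density matrix) `Tᵢ* Tᵢ / Tr (Tᵢ* Tᵢ)` of `T` on the `i`-th
party, where `Tᵢ` is the `i`-th flattening. -/
noncomputable def marginal (T : Tensor ι) (i : Fin k) : Matrix (ι i) (ι i) ℂ :=
  (((flattening T i)ᴴ * flattening T i).trace)⁻¹ • ((flattening T i)ᴴ * flattening T i)

theorem marginal_isHermitian (T : Tensor ι) (i : Fin k) : (marginal T i).IsHermitian := by
  have h := Matrix.isHermitian_conjTranspose_mul_self (flattening T i)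
  have ht : star ((flattening T i)ᴴ * flattening T i).trace
      = ((flattening T i)ᴴ * flattening T i).trace := by
    rw [← Matrix.trace_conjTranspose, h.eq]
  rw [Matrix.IsHermitian, marginal, Matrix.conjTranspose_smul, h.eq, star_inv₀, ht]

/-- The eigenvalues, with multiplicity and in non-increasing order, of the `i`-th one-body marginal
of `T`, continued by zeros to an infinite sequence. -/
noncomputable def marginalSpectrum [∀ i, DecidableEq (ι i)] (T : Tensor ι) (i : Fin k) : ℕ → ℝ :=
  fun m => if h : m < Fintype.card (ι i) then (marginal_isHermitian T i).eigenvalues₀ ⟨m, h⟩ else 0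

/-- `T` is a matrix product state with periodic boundary conditions and bond dimension `n` (on `k`
parties, with arbitrary local maps at the sites): it arises from maximally entangled pairs of
`n`-level systems on the edges of the `k`-cycle by applying a linear map at each vertex. -/
def IsPeriodicMPS (n : ℕ) (T : Tensor κ) : Prop :=
  ∃ A : ∀ i, Matrix (κ i) (Fin n × Fin n) ℂ, T = applyLocal A (imm n k)

end

end TensorNetwork

/-! Put b = c - 1, so that n² - n < b. The spectra come from multiplication of polynomials of degree
< b by polynomials of degree < 2, a tensor of format b × (b + 1) × 2 on three consecutive parties
`i₀`, `i₁`, `i₂` and trivial at all others. Evaluation at b + 1 nodes followed by interpolation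
exhibits it as a restriction of the GHZ state (`exists_applyLocal_ghz_eq`). Binomial rescaling makes
the marginal at `i₀` flat of rank b and the one at `i₁` flat of rank b + 1
(`marginalSpectrum_polyMul_first`, `marginalSpectrum_polyMul_second`).

No matrix product state of bond dimension n has such marginals. Suppose one did, in local
eigenbases. Contracting every party but `i₀` and `i₁` leaves an n × n matrix on the bond from `i₂`
to `i₀`. Letting the vector at `i₂` run over a plane gives a pencil of matrices, and over ℂ some
nonzero vector (v, w) makes its member singular. Left multiplication by a singular matrix has rank
at most n² - n < b, so some nonzero u in the b-dimensional support at `i₀` is killed together with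
(v, w) (`IsPeriodicMPS.exists_contraction_eq_zero`). Hence the contraction of T with u, a tensor on
`i₁` and `i₂`, is concentrated on the single direction at `i₂` complementary to (v, w). Its squared
norm relative to ‖u‖² is then at most the largest eigenvalue 1/(b + 1) at `i₁`, whereas flatness at
`i₀` forces it to be 1/b.

The argument is stable: `IsPeriodicMPS.le_add_sum_tail` keeps track of the weight outside the plane
at `i₂` and outside a line at each further party, and `IsPeriodicMPS.inv_sub_inv_le` turns this into
a bound on the gap 1/b - 1/(b + 1) that is linear in ε. -/

namespace TensorNetwork

/-! ### Local maps acting on tensors -/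

section Local

variable {k : ℕ} {ι κ μ : Fin k → Type} [∀ i, Fintype (ι i)]

theorem applyLocal_sum {J : Type*} (s : Finset J) (A : ∀ i, Matrix (κ i) (ι i) ℂ)
    (T : J → Tensor ι) : applyLocal A (∑ j ∈ s, T j) = ∑ j ∈ s, applyLocal A (T j) := by
  funext y
  simp only [applyLocal, Finset.sum_apply, Finset.mul_sum]
  exact Finset.sum_comm

theorem applyLocal_productTensor (A : ∀ i, Matrix (κ i) (ι i) ℂ) (v : ∀ i, ι i → ℂ) :
    applyLocal A (productTensor v) = productTensor (fun i => A i *ᵥ v i) := by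
  classical
  funext y
  simp only [applyLocal, productTensor, Matrix.mulVec, dotProduct, Fintype.prod_sum,
    Finset.prod_mul_distrib]

theorem applyLocal_applyLocal [∀ i, Fintype (κ i)] (B : ∀ i, Matrix (μ i) (κ i) ℂ)
    (A : ∀ i, Matrix (κ i) (ι i) ℂ) (T : Tensor ι) :
    applyLocal B (applyLocal A T) = applyLocal (fun i => B i * A i) T := by
  classical
  funext y
  simp only [applyLocal, Matrix.mul_apply, Fintype.prod_sum, Finset.mul_sum, Finset.sum_mul,
    Finset.prod_mul_distrib]
  rw [Finset.sum_comm]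
  simp only [mul_assoc]

theorem applyLocal_ghz (c : ℕ) (A : ∀ i, Matrix (κ i) (Fin c) ℂ) (y : ∀ i, κ i) :
    applyLocal A (ghz c k) y = ∑ s, ∏ i, A i (y i) s := by
  simp [ghz, applyLocal_sum, applyLocal_productTensor, productTensor, Finset.sum_apply]

theorem applyLocal_imm (n : ℕ) (A : ∀ i, Matrix (κ i) (Fin n × Fin n) ℂ) (y : ∀ i, κ i) :
    applyLocal A (imm n k) y
      = ∑ i : Fin k → Fin n, ∏ l, A l (y l) (i l, i (finRotate k l)) := by
  simp [imm, applyLocal_sum, applyLocal_productTensor, productTensor, Finset.sum_apply]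

/-- This allows a matrix product state to be rotated into local eigenbases of its marginals. -/
theorem IsPeriodicMPS.map_applyLocal [∀ i, Fintype (κ i)] {n : ℕ} {T : Tensor κ}
    (hT : IsPeriodicMPS n T) (B : ∀ i, Matrix (μ i) (κ i) ℂ) :
    IsPeriodicMPS n (applyLocal B T) := by
  obtain ⟨A, rfl⟩ := hT
  exact ⟨fun i => B i * A i, applyLocal_applyLocal B A _⟩

end Local

/-! ### Summation over one bond, and singular matrices in pencils -/

/-- A sum over `i : β → α` of a product of a function of `i b` and a function independent of
`i b` may be computed by fixing `i b` in the second factor. -/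
theorem sum_pi_eq_sum_sum_update {α β M : Type*} [Fintype α] [Fintype β] [DecidableEq α]
    [DecidableEq β] [AddCommMonoid M] (b : β) (o : α) (f : (β → α) → M) :
    ∑ i, f i = ∑ s, ∑ i, if i b = o then f (Function.update i b s) else 0 := by
  rw [← Fintype.sum_prod_type' (f := fun s i => if i b = o then f (Function.update i b s) else 0),
    ← Finset.sum_filter]
  refine Finset.sum_bij' (fun i _ => (i b, Function.update i b o))
    (fun p _ => Function.update p.2 b p.1) ?_ ?_ ?_ ?_ ?_
  · simp
  · simp
  · simp
  · rintro ⟨s, i⟩ h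
    simp only [Finset.mem_filter, Finset.mem_univ, true_and] at h
    simp [← h]
  · simp

/-- In a pencil of square complex matrices of positive size, some nontrivial combination is
singular. -/
theorem exists_det_smul_add_smul_eq_zero {n : ℕ} (hn : 0 < n) (M N : Matrix (Fin n) (Fin n) ℂ) :
    ∃ v w : ℂ, (v ≠ 0 ∨ w ≠ 0) ∧ (v • M + w • N).det = 0 := by
  by_cases hM : M.det = 0
  · exact ⟨1, 0, by simp, by simpa using hM⟩
  have : Nonempty (Fin n) := ⟨⟨0, hn⟩⟩
  -- For invertible M, an eigenvalue z of M⁻¹N makes N - zM singular.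
  obtain ⟨z, hz⟩ := Module.End.exists_eigenvalue (Matrix.toLin' (M⁻¹ * N))
  obtain ⟨x, hx⟩ := hz.exists_hasEigenvector
  refine ⟨-z, 1, by simp, ?_⟩
  rw [← Matrix.exists_mulVec_eq_zero_iff]
  refine ⟨x, hx.2, ?_⟩
  have h := hx.apply_eq_smul
  rw [Matrix.toLin'_apply] at h
  have h2 := congrArg (M *ᵥ ·) h
  simp only [Matrix.mulVec_mulVec, Matrix.mulVec_smul] at h2
  rw [← mul_assoc, Matrix.mul_nonsing_inv _ (isUnit_iff_ne_zero.mpr hM), one_mul] at h2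
  rw [Matrix.add_mulVec, Matrix.smul_mulVec, Matrix.smul_mulVec, h2, one_smul, neg_smul,
    neg_add_cancel]

/-- Left multiplication by a singular `n × n` matrix kills a nonzero element in every parametrised
family of `n × n` matrices with more than `n ^ 2 - n` parameters. -/
theorem exists_mul_sum_smul_eq_zero {n : ℕ} {N : Matrix (Fin n) (Fin n) ℂ} (hN : N.det = 0)
    {α : Type*} [Fintype α] (S : Finset α) (hS : n ^ 2 - n < S.card)
    (B : α → Matrix (Fin n) (Fin n) ℂ) :
    ∃ u : α → ℂ, u ≠ 0 ∧ (∀ a ∉ S, u a = 0) ∧ N * ∑ a, u a • B a = 0 := by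
  classical
  obtain ⟨z, hz, hzN⟩ := Matrix.exists_vecMul_eq_zero_iff.mpr hN
  obtain ⟨p, hp⟩ := Function.ne_iff.mp hz
  -- Only the rows other than p are imposed, which is n² - n equations; since z annihilates N from
  -- the left and its entry at p is nonzero, row p then vanishes as well.
  let L : (S → ℂ) →ₗ[ℂ] ({q : Fin n // q ≠ p} × Fin n → ℂ) :=
    { toFun := fun u x => (N * ∑ a : S, u a • B a) x.1 x.2
      map_add' := fun u v => by
        funext x
        simp [add_smul, Finset.sum_add_distrib, mul_add]
      map_smul' := fun r u => by
        funext x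
        simp [mul_smul, ← Finset.smul_sum] }
  have hcard : Module.finrank ℂ ({q : Fin n // q ≠ p} × Fin n → ℂ)
      < Module.finrank ℂ (S → ℂ) := by
    simp only [Module.finrank_fintype_fun_eq_card, Fintype.card_prod, Fintype.card_fin,
      Fintype.card_coe, Fintype.card_subtype_compl, Fintype.card_subtype_eq]
    rwa [Nat.sub_mul, one_mul, ← sq]
  obtain ⟨u, hu, hu0⟩ := Submodule.exists_mem_ne_zero_of_ne_bot
    (LinearMap.ker_ne_bot_of_finrank_lt hcard)
  have hu' : L u = 0 := LinearMap.mem_ker.mp hu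
  have hL : ∀ q, q ≠ p → ∀ s, (N * ∑ a : S, u a • B a) q s = 0 := fun q hq s =>
    congrFun hu' (⟨q, hq⟩, s)
  have hM : N * ∑ a : S, u a • B a = 0 := by
    ext q s
    by_cases hq : q = p
    · subst hq
      have h : (z ᵥ* (N * ∑ a : S, u a • B a)) s = 0 := by
        rw [← Matrix.vecMul_vecMul, hzN, Matrix.zero_vecMul, Pi.zero_apply]
      rw [Matrix.vecMul, dotProduct, Finset.sum_eq_single q] at h
      · exact (mul_eq_zero.mp h).resolve_left hp
      · intro r _ hr
        rw [hL r hr, mul_zero]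
      · simp
    · exact hL q hq s
  refine ⟨fun a => if h : a ∈ S then u ⟨a, h⟩ else 0, ?_, fun a ha => by simp [ha], ?_⟩
  · obtain ⟨a, ha⟩ := Function.ne_iff.mp hu0
    exact Function.ne_iff.mpr ⟨a, by simpa using ha⟩
  · rw [← hM, ← Finset.sum_subset (Finset.subset_univ S)
      (fun a _ ha => by simp [ha]), ← Finset.sum_coe_sort]
    simp

/-! ### Exact degeneracy of matrix product states -/

section MPS

variable {k n : ℕ} {κ : Fin k → Type}

/-- Contracting all parties of a matrix product state other than `i₀` and `i₁` leaves a single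
matrix on the bond from `i₂` to `i₀`. -/
theorem applyLocal_imm_eq_sum_mul (hn : 0 < n) {i₀ i₁ i₂ : Fin k} (h01 : i₀ ≠ i₁)
    (h21 : i₂ ≠ i₁)
    (hr0 : finRotate k i₀ = i₁) (hr1 : finRotate k i₁ = i₂)
    (A : ∀ i, Matrix (κ i) (Fin n × Fin n) ℂ) :
    ∃ N : (∀ i, κ i) → Matrix (Fin n) (Fin n) ℂ,
      (∀ x y : ∀ i, κ i, (∀ i, i ≠ i₀ → i ≠ i₁ → x i = y i) → N x = N y) ∧
      ∀ y, applyLocal A (imm n k) y = ∑ s, ∑ p,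
        A i₁ (y i₁) (s, p) * (N y * Matrix.of fun q r => A i₀ (y i₀) (q, r)) p s := by
  classical
  -- A dummy value for the bond between `i₀` and `i₁`, on which no factor of `G` depends; freezing
  -- it avoids counting each configuration n times.
  let o : Fin n := ⟨0, hn⟩
  let E : Finset (Fin k) := (Finset.univ.erase i₀).erase i₁
  let G : (∀ i, κ i) → (Fin k → Fin n) → ℂ := fun x i =>
    ∏ l ∈ E, A l (x l) (i l, i (finRotate k l))
  refine ⟨fun x => Matrix.of fun p q => ∑ i : Fin k → Fin n,
    if i i₁ = o then if i i₂ = p then if i i₀ = q then G x i else 0 else 0 else 0, ?_, ?_⟩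
  · intro x y h
    have : G x = G y := by
      funext i
      refine Finset.prod_congr rfl fun l hl => ?_
      simp only [E, Finset.mem_erase, Finset.mem_univ, and_true] at hl
      rw [h l hl.2 hl.1]
    simp only [this]
  · intro y
    rw [applyLocal_imm]
    have hsplit : ∀ i : Fin k → Fin n, ∏ l, A l (y l) (i l, i (finRotate k l))
        = A i₁ (y i₁) (i i₁, i i₂) * A i₀ (y i₀) (i i₀, i i₁) * G y i := by
      intro i
      rw [← Finset.mul_prod_erase _ _ (Finset.mem_univ i₀),
        ← Finset.mul_prod_erase _ _ (Finset.mem_erase.mpr ⟨h01.symm, Finset.mem_univ i₁⟩), hr0, hr1]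
      ring
    have hG : ∀ (i : Fin k → Fin n) s, G y (Function.update i i₁ s) = G y i := by
      intro i s
      refine Finset.prod_congr rfl fun l hl => ?_
      simp only [E, Finset.mem_erase, Finset.mem_univ, and_true] at hl
      have : finRotate k l ≠ i₁ := fun h => hl.2 ((finRotate k).injective (h.trans hr0.symm))
      rw [Function.update_of_ne hl.1, Function.update_of_ne this]
    rw [sum_pi_eq_sum_sum_update i₁ o]
    refine Finset.sum_congr rfl fun s _ => ?_
    simp only [hsplit, hG, Function.update_self, Function.update_of_ne h01,
      Function.update_of_ne h21, Matrix.mul_apply, Matrix.of_apply, Finset.mul_sum, Finset.sum_mul]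
    have hrhs : ∀ i : Fin k → Fin n, (∑ p, ∑ q, A i₁ (y i₁) (s, p) *
        ((if i i₁ = o then if i i₂ = p then if i i₀ = q then G y i else 0 else 0 else 0)
          * A i₀ (y i₀) (q, s)))
        = if i i₁ = o then A i₁ (y i₁) (s, i i₂) * A i₀ (y i₀) (i i₀, s) * G y i else 0 := by
      intro i
      split_ifs with h
      · rw [Finset.sum_eq_single (i i₂) (fun p _ hp => by simp [hp.symm]) (by simp),
          Finset.sum_eq_single (i i₀) (fun p _ hp => by simp [hp.symm]) (by simp)]
        simp
        ring
      · simp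
    rw [← Finset.sum_congr rfl (fun i _ => hrhs i), Finset.sum_comm]
    refine Finset.sum_congr rfl fun p _ => ?_
    exact Finset.sum_comm

/-- In a matrix product state of bond dimension `n`, contracting the party `i₂` with a suitable
nonzero combination of any two basis vectors makes the flattening between `i₀` and `i₁` degenerate
on every coordinate subspace of dimension larger than `n ^ 2 - n`. -/
theorem IsPeriodicMPS.exists_contraction_eq_zero [∀ i, Fintype (κ i)] {T : Tensor κ}
    (hT : IsPeriodicMPS n T) (hn : 0 < n) {i₀ i₁ i₂ : Fin k} (h01 : i₀ ≠ i₁)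
    (h21 : i₂ ≠ i₁)
    (hr0 : finRotate k i₀ = i₁) (hr1 : finRotate k i₁ = i₂) (base : ∀ i, κ i) (e₀ e₁ : κ i₂)
    (S : Finset (κ i₀)) (hS : n ^ 2 - n < S.card) :
    ∃ v w : ℂ, (v ≠ 0 ∨ w ≠ 0) ∧ ∃ u : κ i₀ → ℂ, u ≠ 0 ∧ (∀ a ∉ S, u a = 0) ∧
      ∀ m, ∑ a, u a * (v * T (Function.update (Function.update (Function.update base i₂ e₀) i₁ m)
          i₀ a)
        + w * T (Function.update (Function.update (Function.update base i₂ e₁) i₁ m) i₀ a)) = 0 := by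
  classical
  obtain ⟨A, rfl⟩ := hT
  obtain ⟨N, hN, hA⟩ := applyLocal_imm_eq_sum_mul hn h01 h21 hr0 hr1 A
  obtain ⟨v, w, hvw, hdet⟩ := exists_det_smul_add_smul_eq_zero hn
    (N (Function.update base i₂ e₀)) (N (Function.update base i₂ e₁))
  obtain ⟨u, hu, huS, hker⟩ := exists_mul_sum_smul_eq_zero hdet S hS
    (fun a => Matrix.of fun q r => A i₀ a (q, r))
  refine ⟨v, w, hvw, u, hu, huS, fun m => ?_⟩
  have key : ∀ e a, applyLocal A (imm n k)
      (Function.update (Function.update (Function.update base i₂ e) i₁ m) i₀ a)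
      = ∑ s, ∑ p, A i₁ m (s, p) *
        (N (Function.update base i₂ e) * Matrix.of fun q r => A i₀ a (q, r)) p s := by
    intro e a
    rw [hA, hN _ (Function.update base i₂ e)
      (fun i h0 h1 => by rw [Function.update_of_ne h0, Function.update_of_ne h1]),
      Function.update_self, Function.update_of_ne h01.symm, Function.update_self]
  have hzero : ∑ s, ∑ p, A i₁ m (s, p) * ((v • N (Function.update base i₂ e₀)
      + w • N (Function.update base i₂ e₁)) *
        ∑ a, u a • Matrix.of fun q r => A i₀ a (q, r)) p s = 0 := by
    simp only [hker, Matrix.zero_apply, mul_zero, Finset.sum_const_zero]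
  rw [← hzero]
  simp only [key, Matrix.sum_apply, Matrix.mul_smul, Matrix.smul_apply,
    Matrix.add_mul, Matrix.add_apply, Matrix.smul_mul, smul_eq_mul, Finset.mul_sum,
    ← Finset.sum_add_distrib]
  rw [Finset.sum_comm]
  refine Finset.sum_congr rfl fun s _ => ?_
  rw [Finset.sum_comm]
  refine Finset.sum_congr rfl fun p _ => Finset.sum_congr rfl fun a _ => ?_
  ring

end MPS

end TensorNetwork

namespace TensorNetwork

/-! ### Norm estimates for matrices with orthogonal columns -/

section Orthogonal

variable {R α : Type*} [Fintype R] [Fintype α] [DecidableEq α] {M : Matrix R α ℂ} {l : α → ℝ}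

/-- Both sides are the quadratic form of the Gram matrix. For a flattening, this converts eigenvalue
bounds into norm bounds for contractions. -/
theorem sum_norm_sq_mulVec (h : Mᴴ * M = Matrix.diagonal fun a => (l a : ℂ)) (x : α → ℂ) :
    ∑ r, ‖(M *ᵥ x) r‖ ^ 2 = ∑ a, l a * ‖x a‖ ^ 2 := by
  have h1 : star (M *ᵥ x) ⬝ᵥ (M *ᵥ x) = star x ⬝ᵥ ((Mᴴ * M) *ᵥ x) := by
    rw [Matrix.star_mulVec, ← Matrix.mulVec_mulVec, Matrix.dotProduct_mulVec,
      Matrix.dotProduct_mulVec, Matrix.dotProduct_mulVec]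
  rw [h] at h1
  have h2 : ((∑ r, ‖(M *ᵥ x) r‖ ^ 2 : ℝ) : ℂ) = ((∑ a, l a * ‖x a‖ ^ 2 : ℝ) : ℂ) := by
    push_cast
    simp only [← Complex.conj_mul']
    refine Eq.trans h1 ?_
    simp only [dotProduct, Matrix.mulVec_diagonal, Pi.star_apply, RCLike.star_def]
    exact Finset.sum_congr rfl fun a _ => by ring
  exact_mod_cast h2

theorem sum_norm_sq_col (h : Mᴴ * M = Matrix.diagonal fun a => (l a : ℂ)) (a : α) :
    ∑ r, ‖M r a‖ ^ 2 = l a := by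
  have := sum_norm_sq_mulVec h (Pi.single a 1)
  rw [Finset.sum_eq_single a (fun b _ hb => by simp [hb]) (by simp)] at this
  simpa using this

/-- Bessel's inequality for a matrix with orthogonal columns of bounded norm, restricted to some
rows. -/
theorem sum_norm_sq_sum_mul_le (h : Mᴴ * M = Matrix.diagonal fun a => (l a : ℂ)) {β : ℝ}
    (hβ0 : 0 ≤ β) (hβ : ∀ a, l a ≤ β) {J : Type*} [Fintype J] {f : J → R}
    (hf : Function.Injective f) (ξ : J → ℂ) :
    ∑ a, ‖∑ j, ξ j * M (f j) a‖ ^ 2 ≤ β * ∑ j, ‖ξ j‖ ^ 2 := by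
  classical
  set g : α → ℂ := fun a => ∑ j, ξ j * M (f j) a with hg
  set s : ℝ := ∑ a, ‖g a‖ ^ 2 with hs
  set X : ℝ := ∑ j, ‖ξ j‖ ^ 2 with hX
  have hs0 : 0 ≤ s := Finset.sum_nonneg fun _ _ => by positivity
  have hX0 : 0 ≤ X := Finset.sum_nonneg fun _ _ => by positivity
  -- Duality: s is a pairing of ξ with M applied to the conjugate of g, so Cauchy-Schwarz yields s²
  -- ≤ X β s.
  have h1 : (s : ℂ) = ∑ j, ξ j * (M *ᵥ star g) (f j) := by
    rw [hs]
    push_cast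
    simp only [← Complex.mul_conj', Matrix.mulVec, dotProduct, Finset.mul_sum]
    rw [Finset.sum_comm]
    refine Finset.sum_congr rfl fun a _ => ?_
    rw [hg, Finset.sum_mul]
    exact Finset.sum_congr rfl fun j _ => by simp [mul_assoc]
  have h2 : s ≤ ∑ j, ‖ξ j‖ * ‖(M *ᵥ star g) (f j)‖ := by
    have : s = ‖(s : ℂ)‖ := by simp [abs_of_nonneg hs0]
    rw [this, h1]
    exact (norm_sum_le _ _).trans (le_of_eq (Finset.sum_congr rfl fun j _ => norm_mul _ _))
  have h3 : ∑ j, ‖(M *ᵥ star g) (f j)‖ ^ 2 ≤ β * s := by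
    calc ∑ j, ‖(M *ᵥ star g) (f j)‖ ^ 2
        = ∑ r ∈ Finset.univ.map ⟨f, hf⟩, ‖(M *ᵥ star g) r‖ ^ 2 := by simp
      _ ≤ ∑ r, ‖(M *ᵥ star g) r‖ ^ 2 :=
          Finset.sum_le_sum_of_subset_of_nonneg (Finset.subset_univ _)
            fun _ _ _ => by positivity
      _ = ∑ a, l a * ‖g a‖ ^ 2 := by simp [sum_norm_sq_mulVec h]
      _ ≤ ∑ a, β * ‖g a‖ ^ 2 := by gcongr with a; exact hβ a
      _ = β * s := by rw [hs, Finset.mul_sum]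
  have h4 : s ^ 2 ≤ X * (β * s) := by
    calc s ^ 2 ≤ (∑ j, ‖ξ j‖ * ‖(M *ᵥ star g) (f j)‖) ^ 2 := by gcongr
      _ ≤ X * ∑ j, ‖(M *ᵥ star g) (f j)‖ ^ 2 := Finset.sum_mul_sq_le_sq_mul_sq _ _ _
      _ ≤ X * (β * s) := by gcongr
  rcases hs0.eq_or_lt with h0 | h0
  · rw [← h0]; positivity
  · nlinarith

end Orthogonal

/-! ### Contractions of tensors with diagonal marginals -/

section Split

variable {k : ℕ} {ι : Fin k → Type}

theorem piSplitAt_symm_restrict (i : Fin k) (x : ∀ j, ι j) (a : ι i) :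
    (Equiv.piSplitAt i ι).symm (a, fun j => x j) = Function.update x i a := by
  funext j
  rw [Equiv.piSplitAt_symm_apply]
  by_cases h : j = i
  · subst h; simp
  · simp [h]

theorem flattening_restrict (T : Tensor ι) (i : Fin k) (x : ∀ j, ι j) (a : ι i) :
    flattening T i (fun j => x j) a = T (Function.update x i a) := by
  rw [flattening, Matrix.of_apply, piSplitAt_symm_restrict]

theorem sum_piSplitAt [∀ i, Fintype (ι i)] {E : Type*} [AddCommMonoid E] (i : Fin k)
    (F : (∀ j, ι j) → E) :
    ∑ y, F y = ∑ a, ∑ r, F ((Equiv.piSplitAt i ι).symm (a, r)) := by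
  rw [← Fintype.sum_prod_type', Equiv.sum_comp (Equiv.piSplitAt i ι).symm F]

theorem sum_norm_sq_filter_eq [∀ i, Fintype (ι i)] [∀ i, DecidableEq (ι i)] {T : Tensor ι}
    {i : Fin k} {l : ι i → ℝ}
    (h : (flattening T i)ᴴ * flattening T i = Matrix.diagonal fun a => (l a : ℂ))
    (E : Finset (ι i)) :
    ∑ y with y i ∈ E, ‖T y‖ ^ 2 = ∑ a ∈ E, l a := by
  rw [Finset.sum_filter, sum_piSplitAt i, ← Finset.sum_filter_add_sum_filter_not _ (· ∈ E)]
  have h1 : ∀ a r, (Equiv.piSplitAt i ι).symm (a, r) i = a := fun a r => by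
    simp [Equiv.piSplitAt_symm_apply]
  simp only [h1]
  rw [Finset.filter_mem_eq_inter, Finset.univ_inter, add_eq_left.mpr]
  · refine Finset.sum_congr rfl fun a ha => ?_
    simp only [ha, if_true]
    exact sum_norm_sq_col h a
  · exact Finset.sum_eq_zero fun a ha => by simp [(Finset.mem_filter.mp ha).2]

/-- Cauchy-Schwarz in the contracted index, row by row, leaves the weight of T on the slices
selected by E. This is the estimate for the tails. -/
theorem sum_norm_sq_contraction_filter_le [∀ i, Fintype (ι i)] [∀ i, DecidableEq (ι i)]
    {T : Tensor ι} {i₀ i : Fin k} (hi : i ≠ i₀) {l : ι i → ℝ}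
    (h : (flattening T i)ᴴ * flattening T i = Matrix.diagonal fun a => (l a : ℂ))
    (E : Finset (ι i)) (u : ι i₀ → ℂ) :
    ∑ r : (∀ j : {j // j ≠ i₀}, ι j) with r ⟨i, hi⟩ ∈ E, ‖(flattening T i₀ *ᵥ u) r‖ ^ 2
      ≤ (∑ a ∈ E, l a) * ∑ a, ‖u a‖ ^ 2 := by
  have h1 : ∀ r, ‖(flattening T i₀ *ᵥ u) r‖ ^ 2
      ≤ (∑ a, ‖flattening T i₀ r a‖ ^ 2) * ∑ a, ‖u a‖ ^ 2 := by
    intro r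
    refine le_trans ?_ (Finset.sum_mul_sq_le_sq_mul_sq _ _ _)
    gcongr
    exact (norm_sum_le _ _).trans (le_of_eq (Finset.sum_congr rfl fun j _ => norm_mul _ _))
  refine (Finset.sum_le_sum fun r _ => h1 r).trans (le_of_eq ?_)
  rw [← Finset.sum_mul, ← sum_norm_sq_filter_eq h E, Finset.sum_filter, Finset.sum_filter,
    sum_piSplitAt i₀, Finset.sum_comm]
  congr 1
  refine Finset.sum_congr rfl fun r _ => ?_
  have h2 : ∀ a, (Equiv.piSplitAt i₀ ι).symm (a, r) i = r ⟨i, hi⟩ := fun a => by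
    simp [Equiv.piSplitAt_symm_apply, hi]
  simp only [h2]
  split_ifs <;> simp [flattening]

/-- A contraction of all parties but `i₁` against a unit vector is bounded by the largest
eigenvalue of the (unnormalised) marginal of `i₁`. -/
theorem sum_norm_sq_two_party_contraction_le [∀ i, Fintype (ι i)] [∀ i, DecidableEq (ι i)]
    {T : Tensor ι} {i₀ i₁ i₂ : Fin k} (h01 : i₀ ≠ i₁) (h02 : i₀ ≠ i₂) (h21 : i₂ ≠ i₁)
    {l : ι i₁ → ℝ}
    (h : (flattening T i₁)ᴴ * flattening T i₁ = Matrix.diagonal fun a => (l a : ℂ))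
    {β : ℝ} (hβ0 : 0 ≤ β) (hβ : ∀ a, l a ≤ β) (base : ∀ i, ι i) {B : Type*} [Fintype B]
    {q : B → ι i₂} (hq : Function.Injective q) (u : ι i₀ → ℂ) (ω : B → ℂ) :
    ∑ m, ‖∑ b, ω b * ∑ a, u a * T (Function.update (Function.update (Function.update base i₂ (q b))
        i₁ m) i₀ a)‖ ^ 2 ≤ β * ((∑ a, ‖u a‖ ^ 2) * ∑ b, ‖ω b‖ ^ 2) := by
  let f : ι i₀ × B → ∀ j : {j // j ≠ i₁}, ι j := fun x j =>
    Function.update (Function.update base i₂ (q x.2)) i₀ x.1 j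
  have hf : Function.Injective f := by
    rintro ⟨a, b⟩ ⟨a', b'⟩ hab
    have h0 := congrFun hab ⟨i₀, h01⟩
    have h2 := congrFun hab ⟨i₂, h21⟩
    simp only [f, Function.update_self, Function.update_of_ne h02.symm] at h0 h2
    rw [h0, hq h2]
  have key := sum_norm_sq_sum_mul_le h hβ0 hβ hf (fun x => u x.1 * ω x.2)
  have hξ : ∑ x : ι i₀ × B, ‖u x.1 * ω x.2‖ ^ 2 = (∑ a, ‖u a‖ ^ 2) * ∑ b, ‖ω b‖ ^ 2 := by
    rw [Fintype.sum_prod_type, Finset.sum_mul_sum]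
    simp only [norm_mul, mul_pow]
  rw [hξ] at key
  refine le_trans (le_of_eq ?_) key
  refine Finset.sum_congr rfl fun m _ => ?_
  rw [Fintype.sum_prod_type_right]
  congr 2
  refine Finset.sum_congr rfl fun b _ => ?_
  rw [Finset.mul_sum]
  refine Finset.sum_congr rfl fun a _ => ?_
  rw [flattening_restrict, Function.update_comm h01]
  ring

end Split

/-! ### Quantitative obstruction for matrix product states -/

section MPS

variable {k n : ℕ} {ι : Fin k → Type} [∀ i, Fintype (ι i)] [∀ i, DecidableEq (ι i)]

/-- In a matrix product state whose `i₁`-marginal is bounded by `β`, some vector supported on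
any coordinate subspace of dimension larger than `n ^ 2 - n` at party `i₀` has, inside a
two-dimensional coordinate subspace of `i₂`, only a small contraction. -/
theorem IsPeriodicMPS.exists_small_contraction {T : Tensor ι} (hT : IsPeriodicMPS n T)
    (hn : 0 < n) {i₀ i₁ i₂ : Fin k} (h01 : i₀ ≠ i₁) (h02 : i₀ ≠ i₂) (h21 : i₂ ≠ i₁)
    (hr0 : finRotate k i₀ = i₁) (hr1 : finRotate k i₁ = i₂)
    {l : ι i₁ → ℝ}
    (h : (flattening T i₁)ᴴ * flattening T i₁ = Matrix.diagonal fun a => (l a : ℂ))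
    {β : ℝ} (hβ0 : 0 ≤ β) (hβ : ∀ a, l a ≤ β) (base : ∀ i, ι i) (e₀ e₁ : ι i₂)
    (S : Finset (ι i₀)) (hS : n ^ 2 - n < S.card) :
    ∃ u : ι i₀ → ℂ, u ≠ 0 ∧ (∀ a ∉ S, u a = 0) ∧
      ∑ m, ∑ e ∈ {e₀, e₁}, ‖∑ a, u a * T (Function.update (Function.update (Function.update base
        i₂ e) i₁ m) i₀ a)‖ ^ 2 ≤ β * ∑ a, ‖u a‖ ^ 2 := by
  obtain ⟨v, w, hvw, u, hu, huS, hzero⟩ :=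
    hT.exists_contraction_eq_zero hn h01 h21 hr0 hr1 base e₀ e₁ S hS
  refine ⟨u, hu, huS, ?_⟩
  -- The labels coincide when party `i₂` has dimension one; the plane is then a line and the
  -- two-party bound suffices.
  by_cases he : e₀ = e₁
  · subst he
    have := sum_norm_sq_two_party_contraction_le h01 h02 h21 h hβ0 hβ base (B := Unit)
      (q := fun _ => e₀) (fun _ _ _ => rfl) u (fun _ => 1)
    simpa using this
  · have hq : Function.Injective (fun b : Bool => cond b e₀ e₁) := by
      intro b b'
      cases b <;> cases b' <;> simp [he, Ne.symm he]
    have key := sum_norm_sq_two_party_contraction_le h01 h02 h21 h hβ0 hβ base hq u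
      (fun b => cond b (-star w) (star v))
    set Φ : ι i₂ → ι i₁ → ℂ := fun e m => ∑ a, u a * T (Function.update (Function.update
      (Function.update base i₂ e) i₁ m) i₀ a) with hΦ
    have hz : ∀ m, v * Φ e₀ m + w * Φ e₁ m = 0 := by
      intro m
      rw [← hzero m, hΦ, Finset.mul_sum, Finset.mul_sum, ← Finset.sum_add_distrib]
      exact Finset.sum_congr rfl fun a _ => by ring
    simp only [Fintype.sum_bool, cond_true, cond_false, norm_neg, norm_star] at key
    have hpos : 0 < ‖w‖ ^ 2 + ‖v‖ ^ 2 := by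
      rcases hvw with h | h
      · have := norm_pos_iff.mpr h; positivity
      · have := norm_pos_iff.mpr h; positivity
    -- Lagrange's identity, whose remaining term |v Φ(e₀) + w Φ(e₁)|² vanishes: the complementary
    -- direction carries the full norm.
    have hid : ∀ m, ‖-star w * Φ e₀ m + star v * Φ e₁ m‖ ^ 2
        = (‖w‖ ^ 2 + ‖v‖ ^ 2) * ∑ e ∈ {e₀, e₁}, ‖Φ e m‖ ^ 2 := by
      intro m
      rw [Finset.sum_pair he]
      have h1 := hz m
      apply Complex.ofReal_injective
      push_cast
      simp only [← Complex.conj_mul', map_add, map_mul, map_neg, RCLike.star_def, Complex.conj_conj]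
      linear_combination (-(starRingEnd ℂ) v * (starRingEnd ℂ) (Φ e₀ m)
        - (starRingEnd ℂ) w * (starRingEnd ℂ) (Φ e₁ m)) * h1
    change ∑ m, ‖-star w * Φ e₀ m + star v * Φ e₁ m‖ ^ 2 ≤ _ at key
    change ∑ m, ∑ e ∈ {e₀, e₁}, ‖Φ e m‖ ^ 2 ≤ _
    rw [Finset.sum_congr rfl fun m _ => hid m, ← Finset.mul_sum] at key
    nlinarith

/-- The spectral gap between the first two (diagonal, unnormalised) marginals of a matrix product
state of bond dimension `n` is controlled by the weight of the other marginals outside of a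
two-dimensional subspace at the third party and a line at all later parties. -/
theorem IsPeriodicMPS.le_add_sum_tail {T : Tensor ι} (hT : IsPeriodicMPS n T)
    (hn : 0 < n) {i₀ i₁ i₂ : Fin k} (h01 : i₀ ≠ i₁) (h02 : i₀ ≠ i₂) (h21 : i₂ ≠ i₁)
    (hr0 : finRotate k i₀ = i₁) (hr1 : finRotate k i₁ = i₂)
    {l : ∀ i, ι i → ℝ}
    (h : ∀ i, (flattening T i)ᴴ * flattening T i = Matrix.diagonal fun a => (l i a : ℂ))
    {α β : ℝ} (hβ0 : 0 ≤ β) (hβ : ∀ a, l i₁ a ≤ β) (base : ∀ i, ι i) (e₀ e₁ : ι i₂)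
    (S : Finset (ι i₀)) (hS : n ^ 2 - n < S.card) (hα : ∀ a ∈ S, α ≤ l i₀ a)
    (E : ∀ i, Finset (ι i)) (hE₂ : E i₂ ⊆ {e₀, e₁})
    (hE : ∀ i, i ≠ i₀ → i ≠ i₁ → i ≠ i₂ → E i ⊆ {base i}) :
    α ≤ β + ∑ i with i ≠ i₀ ∧ i ≠ i₁, ∑ a ∈ (E i)ᶜ, l i a := by
  obtain ⟨u, hu, huS, hcore⟩ := hT.exists_small_contraction hn h01 h02 h21 hr0 hr1 (h i₁) hβ0 hβ
    base e₀ e₁ S hS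
  set X := ∑ a, ‖u a‖ ^ 2 with hX
  have hX0 : 0 < X := by
    obtain ⟨a, ha⟩ := Function.ne_iff.mp hu
    have : 0 < ‖u a‖ := norm_pos_iff.mpr ha
    exact Finset.sum_pos' (fun _ _ => by positivity) ⟨a, Finset.mem_univ _, by positivity⟩
  set Φ := flattening T i₀ *ᵥ u with hΦ
  have hlow : α * X ≤ ∑ r, ‖Φ r‖ ^ 2 := by
    rw [sum_norm_sq_mulVec (h i₀), hX, Finset.mul_sum]
    refine Finset.sum_le_sum fun a _ => ?_
    by_cases ha : a ∈ S
    · have := hα a ha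
      gcongr
    · simp [huS a ha]
  let P : (∀ j : {j // j ≠ i₀}, ι j) → Prop := fun r =>
    ∀ j : {j // j ≠ i₀}, j.1 ≠ i₁ → r j ∈ E j
  -- Union bound: a row violating `P` is charged to a party whose index leaves E.
  have hsplit : ∀ r, ‖Φ r‖ ^ 2 ≤ (∑ i with i ≠ i₀ ∧ i ≠ i₁,
      if hi : i ≠ i₀ then (if r ⟨i, hi⟩ ∈ (E i)ᶜ then ‖Φ r‖ ^ 2 else 0) else 0)
      + if P r then ‖Φ r‖ ^ 2 else 0 := by
    intro r
    by_cases hr : P r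
    · rw [if_pos hr]
      refine le_add_of_nonneg_left (Finset.sum_nonneg fun i _ => ?_)
      split_ifs <;> positivity
    · rw [if_neg hr, add_zero]
      simp only [P, not_forall] at hr
      obtain ⟨⟨j, hj0⟩, hj1, hj⟩ := hr
      refine le_trans (le_of_eq ?_) (Finset.single_le_sum (a := j) (fun i _ => ?_) ?_)
      · simp [hj0, hj]
      · split_ifs <;> positivity
      · simp [hj0]; exact hj1
  have htail : ∑ r, (∑ i with i ≠ i₀ ∧ i ≠ i₁,
      if hi : i ≠ i₀ then (if r ⟨i, hi⟩ ∈ (E i)ᶜ then ‖Φ r‖ ^ 2 else 0) else 0)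
      ≤ (∑ i with i ≠ i₀ ∧ i ≠ i₁, ∑ a ∈ (E i)ᶜ, l i a) * X := by
    rw [Finset.sum_comm, Finset.sum_mul]
    refine Finset.sum_le_sum fun i hi => ?_
    have hi0 : i ≠ i₀ := (Finset.mem_filter.mp hi).2.1
    simp only [dif_pos hi0]
    rw [← Finset.sum_filter]
    exact sum_norm_sq_contraction_filter_le hi0 (h i) (E i)ᶜ u
  -- On `P` only the indices at `i₁` and `i₂` can vary, the latter within {e₀, e₁}, so these rows
  -- embed into the sum bounded by `hcore`.
  have hP : ∑ r, (if P r then ‖Φ r‖ ^ 2 else 0) ≤ β * X := by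
    refine le_trans ?_ hcore
    rw [← Finset.sum_filter, ← Finset.sum_product']
    let g : ι i₁ × ι i₂ → ∀ j : {j // j ≠ i₀}, ι j := fun x j =>
      Function.update (Function.update base i₂ x.2) i₁ x.1 j
    have hg : Function.Injective g := by
      rintro ⟨a, b⟩ ⟨a', b'⟩ hab
      have h1 := congrFun hab ⟨i₁, h01.symm⟩
      have h2 := congrFun hab ⟨i₂, h02.symm⟩
      simp only [g, Function.update_self, Function.update_of_ne h21] at h1 h2
      rw [h1, h2]
    have hsub : (Finset.univ.filter P) ⊆ (Finset.univ ×ˢ {e₀, e₁}).map ⟨g, hg⟩ := by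
      intro r hr
      have hr : P r := (Finset.mem_filter.mp hr).2
      refine Finset.mem_map.mpr ⟨(r ⟨i₁, h01.symm⟩, r ⟨i₂, h02.symm⟩), ?_, ?_⟩
      · simp only [Finset.mem_product, Finset.mem_univ, true_and]
        exact hE₂ (hr ⟨i₂, h02.symm⟩ h21)
      · funext ⟨j, hj⟩
        by_cases h1 : j = i₁
        · subst h1; simp [g]
        by_cases h2 : j = i₂
        · subst h2; simp [g, h1]
        · have := hE j hj h1 h2 (hr ⟨j, hj⟩ h1)
          simpa [g, h1, h2] using (Finset.mem_singleton.mp this).symm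
    refine (Finset.sum_le_sum_of_subset_of_nonneg hsub fun _ _ _ => by positivity).trans
      (le_of_eq ?_)
    rw [Finset.sum_map]
    refine Finset.sum_congr rfl fun x _ => ?_
    congr 2
    simp only [hΦ, Matrix.mulVec, dotProduct, Function.Embedding.coeFn_mk, g, flattening_restrict]
    exact Finset.sum_congr rfl fun a _ => mul_comm _ _
  have htotal : α * X ≤ (β + ∑ i with i ≠ i₀ ∧ i ≠ i₁, ∑ a ∈ (E i)ᶜ, l i a) * X := by
    calc α * X ≤ ∑ r, ‖Φ r‖ ^ 2 := hlow
      _ ≤ _ := Finset.sum_le_sum fun r _ => hsplit r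
      _ ≤ _ := by rw [Finset.sum_add_distrib]; linarith
  exact le_of_mul_le_mul_right htotal hX0

end MPS

end TensorNetwork

/-! ### Diagonalisation of marginals and their ordered spectra -/

namespace TensorNetwork

variable {k : ℕ} {ι κ : Fin k → Type} [∀ i, Fintype (ι i)]

theorem prod_piSplitAt_symm {ι : Fin k → Type} (i : Fin k) (g : ∀ j, ι j → ℂ) (a : ι i)
    (r : ∀ j : {j // j ≠ i}, ι j) :
    ∏ j, g j ((Equiv.piSplitAt i ι).symm (a, r) j) = (∏ j : {j // j ≠ i}, g j (r j)) * g i a := by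
  rw [← Fintype.prod_subtype_mul_prod_subtype (fun j => j ≠ i)]
  congr 1
  · exact Finset.prod_congr rfl fun j _ => by simp [Equiv.piSplitAt_symm_apply, j.2]
  · have : Unique {j // ¬ j ≠ i} := ⟨⟨⟨i, by simp⟩⟩, fun j => Subtype.ext (not_not.mp j.2)⟩
    rw [Fintype.prod_unique]
    have h : (default : {j // ¬ j ≠ i}).1 = i := not_not.mp (default : {j // ¬ j ≠ i}).2
    have h2 : ∀ j : Fin k, j = i → g j ((Equiv.piSplitAt i ι).symm (a, r) j) = g i a := by
      rintro j rfl
      simp [Equiv.piSplitAt_symm_apply]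
    exact h2 _ h

theorem flattening_applyLocal (A : ∀ i, Matrix (κ i) (ι i) ℂ) (T : Tensor ι) (i : Fin k) :
    flattening (applyLocal A T) i
      = (Matrix.of fun (r : ∀ j : {j // j ≠ i}, κ j) (s : ∀ j : {j // j ≠ i}, ι j) =>
          ∏ j : {j // j ≠ i}, A j (r j) (s j)) * flattening T i * (A i)ᵀ := by
  ext r b
  simp only [flattening, applyLocal, Matrix.of_apply, Matrix.mul_apply, Matrix.transpose_apply,
    Finset.sum_mul]
  rw [sum_piSplitAt i]
  refine Finset.sum_congr rfl fun a _ => Finset.sum_congr rfl fun s _ => ?_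
  have h := prod_piSplitAt_symm (ι := fun j => κ j × ι j) i (fun j x => A j x.1 x.2) (b, a)
    (fun j => (r j, s j))
  have h2 : ∀ j, (Equiv.piSplitAt i (fun j => κ j × ι j)).symm ((b, a), fun j => (r j, s j)) j
      = ((Equiv.piSplitAt i κ).symm (b, r) j, (Equiv.piSplitAt i ι).symm (a, s) j) := by
    intro j
    simp only [Equiv.piSplitAt_symm_apply]
    by_cases hj : j = i
    · subst hj; simp
    · simp [hj]
  simp only [h2] at h
  rw [h]
  ring

/-- The other parties act on the rows of the flattening by a tensor product `K` of isometries, which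
cancels in the Gram matrix. -/
theorem conjTranspose_mul_self_flattening_applyLocal [∀ i, DecidableEq (ι i)]
    [∀ i, Fintype (κ i)] (A : ∀ i, Matrix (κ i) (ι i) ℂ) (hA : ∀ i, (A i)ᴴ * A i = 1)
    (T : Tensor ι) (i : Fin k) :
    (flattening (applyLocal A T) i)ᴴ * flattening (applyLocal A T) i
      = ((A i)ᵀ)ᴴ * ((flattening T i)ᴴ * flattening T i) * (A i)ᵀ := by
  rw [flattening_applyLocal]
  set K := (Matrix.of fun (r : ∀ j : {j // j ≠ i}, κ j) (s : ∀ j : {j // j ≠ i}, ι j) =>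
    ∏ j : {j // j ≠ i}, A j (r j) (s j)) with hK
  have hKK : Kᴴ * K = 1 := by
    ext s t
    have h : ∀ j : {j // j ≠ i}, ∑ x, star (A j x (s j)) * A j x (t j)
        = if s j = t j then 1 else 0 := fun j => by
      have := congrFun (congrFun (hA j) (s j)) (t j)
      rwa [Matrix.mul_apply, Matrix.one_apply] at this
    simp only [Matrix.mul_apply, Matrix.conjTranspose_apply, hK, Matrix.of_apply, star_prod,
      ← Finset.prod_mul_distrib]
    rw [← Fintype.prod_sum fun (j : {j // j ≠ i}) x => star (A j x (s j)) * A j x (t j)]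
    simp only [h, Matrix.one_apply]
    by_cases hst : s = t
    · simp [hst]
    · obtain ⟨j, hj⟩ := Function.ne_iff.mp hst
      rw [if_neg hst]
      exact Finset.prod_eq_zero (Finset.mem_univ j) (if_neg hj)
  simp only [Matrix.conjTranspose_mul, Matrix.mul_assoc]
  rw [← Matrix.mul_assoc Kᴴ K, hKK, Matrix.one_mul]

theorem trace_conjTranspose_mul_self_flattening (T : Tensor ι) (i : Fin k) :
    ((flattening T i)ᴴ * flattening T i).trace = ((∑ y, ‖T y‖ ^ 2 : ℝ) : ℂ) := by
  rw [sum_piSplitAt i]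
  push_cast
  simp only [Matrix.trace, Matrix.diag, Matrix.mul_apply, ← Complex.conj_mul']
  rfl

theorem sum_norm_sq_pos {T : Tensor ι} (hT : T ≠ 0) : 0 < ∑ y, ‖T y‖ ^ 2 := by
  obtain ⟨y, hy⟩ := Function.ne_iff.mp hT
  have : 0 < ‖T y‖ := norm_pos_iff.mpr hy
  exact Finset.sum_pos' (fun _ _ => by positivity) ⟨y, Finset.mem_univ _, by positivity⟩

variable [∀ i, DecidableEq (ι i)]

/-- A nonzero tensor may be rotated locally such that all its marginals become diagonal. -/
theorem exists_applyLocal_diagonal {T : Tensor ι} (hT : T ≠ 0) :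
    ∃ (A : ∀ i, Matrix (ι i) (ι i) ℂ) (t : ℝ), 0 < t ∧ ∀ i,
      (flattening (applyLocal A T) i)ᴴ * flattening (applyLocal A T) i
        = Matrix.diagonal fun a =>
            ((t * (marginal_isHermitian T i).eigenvalues a : ℝ) : ℂ) := by
  let U : ∀ i, Matrix (ι i) (ι i) ℂ := fun i =>
    ((marginal_isHermitian T i).eigenvectorUnitary : Matrix (ι i) (ι i) ℂ)
  have hU : ∀ i, ((U i)ᵀ)ᴴ * (U i)ᵀ = 1 := fun i => by
    have h : U i * (U i)ᴴ = 1 :=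
      Unitary.coe_mul_star_self (marginal_isHermitian T i).eigenvectorUnitary
    rw [← Matrix.transpose_one, ← h, Matrix.transpose_mul]
    rfl
  -- Local maps enter the flattening transposed, so the transposed eigenvector matrix is the right
  -- rotation; t is the squared norm of T, which undoes the trace normalisation.
  refine ⟨fun i => (U i)ᵀ, ∑ y, ‖T y‖ ^ 2, sum_norm_sq_pos hT, fun i => ?_⟩
  have ht : ((∑ y, ‖T y‖ ^ 2 : ℝ) : ℂ) ≠ 0 := by exact_mod_cast (sum_norm_sq_pos hT).ne'
  rw [conjTranspose_mul_self_flattening_applyLocal _ hU, Matrix.transpose_transpose]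
  have hm : (flattening T i)ᴴ * flattening T i = ((∑ y, ‖T y‖ ^ 2 : ℝ) : ℂ) • marginal T i := by
    rw [marginal, trace_conjTranspose_mul_self_flattening, smul_smul, mul_inv_cancel₀ ht, one_smul]
  have hs := (marginal_isHermitian T i).conjStarAlgAut_star_eigenvectorUnitary
  rw [Unitary.conjStarAlgAut_star_apply] at hs
  rw [hm, Matrix.mul_smul, Matrix.smul_mul]
  have hs' : (U i)ᴴ * marginal T i * U i = _ := hs
  rw [hs', ← Matrix.diagonal_smul]
  congr 1
  funext a
  simp

theorem exists_equiv_eigenvalues_eq (T : Tensor ι) (i : Fin k) :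
    ∃ σ : Fin (Fintype.card (ι i)) ≃ ι i,
      ∀ m, (marginal_isHermitian T i).eigenvalues (σ m) = marginalSpectrum T i m := by
  refine ⟨Fintype.equivOfCardEq (Fintype.card_fin _), fun m => ?_⟩
  simp [Matrix.IsHermitian.eigenvalues, marginalSpectrum]

theorem sum_eigenvalues_marginal {T : Tensor ι} (hT : T ≠ 0) (i : Fin k) :
    ∑ a, (marginal_isHermitian T i).eigenvalues a = 1 := by
  have ht : ((∑ y, ‖T y‖ ^ 2 : ℝ) : ℂ) ≠ 0 := by exact_mod_cast (sum_norm_sq_pos hT).ne'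
  have h := (marginal_isHermitian T i).trace_eq_sum_eigenvalues
  have h1 : (marginal T i).trace = 1 := by
    rw [marginal, Matrix.trace_smul, trace_conjTranspose_mul_self_flattening, smul_eq_mul,
      inv_mul_cancel₀ ht]
  rw [h1] at h
  apply Complex.ofReal_injective
  rw [Complex.ofReal_sum, Complex.ofReal_one]
  exact h.symm

theorem marginalSpectrum_eq_zero (T : Tensor ι) (i : Fin k) {m : ℕ}
    (hm : Fintype.card (ι i) ≤ m) : marginalSpectrum T i m = 0 :=
  dif_neg hm.not_gt

/-- The continuation by zeros makes this valid even when r exceeds the local dimension. -/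
theorem sum_eigenvalues_filter_lt (T : Tensor ι) (i : Fin k)
    {σ : Fin (Fintype.card (ι i)) ≃ ι i}
    (hσ : ∀ m, (marginal_isHermitian T i).eigenvalues (σ m) = marginalSpectrum T i m) (r : ℕ) :
    ∑ a with (σ.symm a : ℕ) < r, (marginal_isHermitian T i).eigenvalues a
      = ∑ m ∈ Finset.range r, marginalSpectrum T i m := by
  rw [Finset.sum_filter, ← Equiv.sum_comp σ]
  simp only [Equiv.symm_apply_apply, hσ]
  rw [Fin.sum_univ_eq_sum_range (fun m => if m < r then marginalSpectrum T i m else 0),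
    ← Finset.sum_filter]
  refine Finset.sum_subset (fun m hm => Finset.mem_range.mpr (Finset.mem_filter.mp hm).2) ?_
  intro m hm hm'
  apply marginalSpectrum_eq_zero
  by_contra h
  exact hm' (Finset.mem_filter.mpr ⟨Finset.mem_range.mpr (not_le.mp h), Finset.mem_range.mp hm⟩)

theorem sum_range_marginalSpectrum {T : Tensor ι} (hT : T ≠ 0) (i : Fin k) :
    ∑ m ∈ Finset.range (Fintype.card (ι i)), marginalSpectrum T i m = 1 := by
  obtain ⟨σ, hσ⟩ := exists_equiv_eigenvalues_eq T i
  rw [← sum_eigenvalues_filter_lt T i hσ, ← sum_eigenvalues_marginal hT i]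
  exact Finset.sum_congr (by simp) fun _ _ => rfl

theorem marginalSpectrum_eq_of_smul_one {T : Tensor ι} {i : Fin k} {r : ℝ}
    (h : marginal T i = (r : ℂ) • 1) {m : ℕ} (hm : m < Fintype.card (ι i)) :
    marginalSpectrum T i m = r := by
  obtain ⟨σ, hσ⟩ := exists_equiv_eigenvalues_eq T i
  rw [← hσ ⟨m, hm⟩]
  have h1 := (marginal_isHermitian T i).mulVec_eigenvectorBasis (σ ⟨m, hm⟩)
  have h0 := (marginal_isHermitian T i).eigenvectorBasis.orthonormal.ne_zero (σ ⟨m, hm⟩)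
  set v := (marginal_isHermitian T i).eigenvectorBasis (σ ⟨m, hm⟩)
  set e := (marginal_isHermitian T i).eigenvalues (σ ⟨m, hm⟩)
  rw [h, Matrix.smul_mulVec, Matrix.one_mulVec] at h1
  have hv : v.ofLp ≠ 0 := fun h => h0 (by ext a; exact congrFun h a)
  obtain ⟨a, ha⟩ := Function.ne_iff.mp hv
  have h2 := congrFun h1 a
  simp only [Pi.smul_apply, smul_eq_mul, Complex.real_smul] at h2
  exact_mod_cast (mul_right_cancel₀ ha h2).symm

/-- If the `i`-th flattening has orthogonal columns of equal nonzero norm, then the `i`-th marginal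
has a flat spectrum. -/
theorem marginalSpectrum_eq_inv_card {T : Tensor ι} {i : Fin k} {z : ℂ} (hz : z ≠ 0)
    (h : (flattening T i)ᴴ * flattening T i = z • 1) {m : ℕ} (hm : m < Fintype.card (ι i)) :
    marginalSpectrum T i m = (Fintype.card (ι i) : ℝ)⁻¹ := by
  refine marginalSpectrum_eq_of_smul_one ?_ hm
  rw [marginal, h, Matrix.trace_smul, Matrix.trace_one, smul_smul]
  congr 1
  push_cast
  rw [smul_eq_mul, mul_inv, mul_comm z⁻¹, mul_assoc, inv_mul_cancel₀ hz, mul_one]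

end TensorNetwork

/-! ### The rescaled polynomial multiplication tensor -/

namespace TensorNetwork

section SumThree

variable {k : ℕ} {d : Fin k → ℕ} {i₀ i₁ i₂ : Fin k}

/-- Sums over multi-indices that have only three nontrivial entries. -/
theorem sum_eq_sum_three {M : Type*} [AddCommMonoid M] (h01 : i₀ ≠ i₁) (h02 : i₀ ≠ i₂)
    (h12 : i₁ ≠ i₂) (hd : ∀ i, i ≠ i₀ → i ≠ i₁ → i ≠ i₂ → d i = 1) (G : ℕ → ℕ → ℕ → M) :
    ∑ y : (∀ i, Fin (d i)), G (y i₀) (y i₁) (y i₂)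
      = ∑ p ∈ Finset.range (d i₀), ∑ q ∈ Finset.range (d i₁), ∑ r ∈ Finset.range (d i₂),
          G p q r := by
  simp only [Finset.sum_range]
  rw [← Fintype.sum_prod_type' (f := fun (p : Fin (d i₀)) (q : Fin (d i₁)) =>
    ∑ r : Fin (d i₂), G p q r), ← Fintype.sum_prod_type' (f := fun
      (x : Fin (d i₀) × Fin (d i₁)) (r : Fin (d i₂)) => G x.1 x.2 r)]
  refine Fintype.sum_bijective (fun y => ((y i₀, y i₁), y i₂)) ⟨?_, ?_⟩ _ _ fun y => rfl
  · intro y z h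
    simp only [Prod.mk.injEq] at h
    funext i
    by_cases h0 : i = i₀
    · subst h0; exact h.1.1
    by_cases h1 : i = i₁
    · subst h1; exact h.1.2
    by_cases h2 : i = i₂
    · subst h2; exact h.2
    · have := hd i h0 h1 h2
      apply Fin.ext
      omega
  · rintro ⟨⟨p, q⟩, r⟩
    have hpos : ∀ i, 0 < d i := by
      intro i
      by_cases h0 : i = i₀
      · subst h0; exact p.pos
      by_cases h1 : i = i₁
      · subst h1; exact q.pos
      by_cases h2 : i = i₂
      · subst h2; exact r.pos
      · rw [hd i h0 h1 h2]; exact one_pos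
    refine ⟨Function.update (Function.update (Function.update (fun i => ⟨0, hpos i⟩) i₀ p) i₁ q)
      i₂ r, ?_⟩
    simp [h01, h02, h12]

end SumThree

section Construction

variable {k b : ℕ} {d : Fin k → ℕ} {i₀ i₁ i₂ : Fin k}

/-- The coefficient of the polynomial multiplication tensor of format `b × (b + 1) × 2`, rescaled
such that the first two marginals become uniform. -/
noncomputable def polyMulCoeff (b p q r : ℕ) : ℝ :=
  if q = p + r then if r = 0 then √(b - p) else √(p + 1) else 0

theorem sq_polyMulCoeff {b p q r : ℕ} (hp : p ≤ b) :
    polyMulCoeff b p q r ^ 2 = if q = p + r then if r = 0 then (b - p : ℝ) else p + 1 else 0 := by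
  have : (p : ℝ) ≤ b := by exact_mod_cast hp
  unfold polyMulCoeff
  split_ifs
  · exact Real.sq_sqrt (by linarith)
  · exact Real.sq_sqrt (by positivity)
  · simp

/-- The weights come from diagonal local scalings, by C(b, p + 1)(p + 1) = C(b, p)(b - p); hence
they do not affect being a restriction of a GHZ state. -/
theorem polyMulCoeff_eq_mul {b p q r : ℕ} (hp : p < b) (hr : r < 2) :
    polyMulCoeff b p q r = √((b - p) * b.choose p) * √((b.choose q : ℝ)⁻¹)
      * if q = p + r then 1 else 0 := by
  have hpb : (p : ℝ) ≤ b := by exact_mod_cast hp.le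
  unfold polyMulCoeff
  split_ifs with hq h0
  · subst hq h0
    have : (0 : ℝ) < b.choose p := by exact_mod_cast Nat.choose_pos hp.le
    rw [mul_one, ← Real.sqrt_mul (by nlinarith), add_zero, mul_assoc, mul_inv_cancel₀ this.ne',
      mul_one]
  · obtain rfl : r = 1 := by omega
    subst hq
    have h1 : (0 : ℝ) < b.choose p := by exact_mod_cast Nat.choose_pos hp.le
    have h2 : (0 : ℝ) < b.choose (p + 1) := by exact_mod_cast Nat.choose_pos hp
    have h3 : (b.choose (p + 1) : ℝ) * (p + 1) = b.choose p * (b - p) := by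
      rw [← Nat.cast_sub hp.le]
      exact_mod_cast Nat.choose_succ_right_eq b p
    rw [mul_one, ← Real.sqrt_mul (by nlinarith)]
    congr 1
    field_simp
    linarith
  · simp

/-- The rescaled polynomial multiplication tensor is a restriction of the GHZ state with `b + 1`
levels (by interpolation). -/
theorem exists_applyLocal_ghz_eq (h01 : i₀ ≠ i₁) (h02 : i₀ ≠ i₂) (h12 : i₁ ≠ i₂)
    (hd0 : d i₀ = b) (hd1 : d i₁ = b + 1) (hd2 : d i₂ = 2) :
    ∃ A : ∀ i, Matrix (Fin (d i)) (Fin (b + 1)) ℂ, ∀ y,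
      applyLocal A (ghz (b + 1) k) y = polyMulCoeff b (y i₀) (y i₁) (y i₂) := by
  let x : Fin (b + 1) → ℂ := fun s => (s : ℕ)
  have hx : Function.Injective x := fun s t h => Fin.ext (Nat.cast_injective h)
  let V := Matrix.vandermonde x
  have hV : V⁻¹ * V = 1 := Matrix.nonsing_inv_mul _
    (isUnit_iff_ne_zero.mpr (Matrix.det_vandermonde_ne_zero_iff.mpr hx))
  -- GHZ level s is the node `x s`. Parties `i₀` and `i₂` evaluate monomials there, and `i₁` reads
  -- off a coefficient by the inverse Vandermonde matrix; b + 1 nodes suffice because p + r ≤ b.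
  let f : Fin k → ℕ → Fin (b + 1) → ℂ := fun i m s =>
    if i = i₀ then (√((b - m) * b.choose m) : ℝ) * x s ^ m
    else if i = i₁ then (√((b.choose m : ℝ)⁻¹) : ℝ) *
      (if h : m < b + 1 then V⁻¹ ⟨m, h⟩ s else 0)
    else if i = i₂ then x s ^ m else 1
  refine ⟨fun i => Matrix.of fun m s => f i m s, fun y => ?_⟩
  rw [applyLocal_ghz]
  have hy0 : (y i₀ : ℕ) < b := lt_of_lt_of_eq (y i₀).2 hd0
  have hy1 : (y i₁ : ℕ) < b + 1 := lt_of_lt_of_eq (y i₁).2 hd1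
  have hy2 : (y i₂ : ℕ) < 2 := lt_of_lt_of_eq (y i₂).2 hd2
  have hprod : ∀ s, ∏ i, Matrix.of (fun (m : Fin (d i)) s => f i m s) (y i) s
      = ((√((b - (y i₀ : ℕ)) * b.choose (y i₀)) * √((b.choose (y i₁) : ℝ)⁻¹) : ℝ) : ℂ) *
        (V⁻¹ ⟨y i₁, hy1⟩ s * V s ⟨y i₀ + y i₂, by omega⟩) := by
    intro s
    rw [← Finset.prod_subset (Finset.subset_univ {i₀, i₁, i₂}), Finset.prod_insert (by simp [*]),
      Finset.prod_pair h12]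
    · simp only [Matrix.of_apply, f, if_true, if_neg h01.symm, if_neg h02.symm, if_neg h12.symm,
        dif_pos hy1, V, Matrix.vandermonde_apply, pow_add]
      push_cast
      ring
    · intro i _ hi
      simp only [Finset.mem_insert, Finset.mem_singleton, not_or] at hi
      simp [f, hi]
  simp only [hprod]
  rw [← Finset.mul_sum, ← Matrix.mul_apply, hV, Matrix.one_apply, polyMulCoeff_eq_mul hy0 hy2]
  simp only [Fin.mk.injEq]
  split_ifs <;> simp

/-- Columns with disjoint supports are orthogonal, and the diagonal Gram entries are the weights of
the slices. -/
theorem conjTranspose_mul_self_flattening_eq_smul_one {ι : Fin k → Type} [∀ i, Fintype (ι i)]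
    [∀ i, DecidableEq (ι i)] {T : Tensor ι} {i : Fin k} {z : ℝ}
    (hoff : ∀ r a a', flattening T i r a ≠ 0 → flattening T i r a' ≠ 0 → a = a')
    (hdiag : ∀ a, ∑ y, (if y i = a then ‖T y‖ ^ 2 else 0) = z) :
    (flattening T i)ᴴ * flattening T i = (z : ℂ) • 1 := by
  ext a a'
  rw [Matrix.mul_apply, Matrix.smul_apply, Matrix.one_apply]
  by_cases h : a = a'
  · subst h
    rw [← hdiag a, sum_piSplitAt i, Finset.sum_eq_single a]
    · simp only [Equiv.piSplitAt_symm_apply, dite_true, if_true, smul_eq_mul, mul_one]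
      push_cast
      refine Finset.sum_congr rfl fun r _ => ?_
      rw [Matrix.conjTranspose_apply, RCLike.star_def, Complex.conj_mul']
      simp [flattening]
    · intro c _ hc
      simp [Equiv.piSplitAt_symm_apply, hc]
    · simp
  · rw [if_neg h, smul_zero]
    refine Finset.sum_eq_zero fun r _ => ?_
    rw [Matrix.conjTranspose_apply, mul_eq_zero, star_eq_zero]
    by_contra! hne
    exact h (hoff r a a' hne.1 hne.2)

theorem eq_add_of_polyMulCoeff_ne_zero {b p q r : ℕ} (h : polyMulCoeff b p q r ≠ 0) :
    q = p + r := by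
  by_contra hq
  exact h (if_neg hq)

variable {T : Tensor fun i => Fin (d i)}

/-- In q = p + r, the pair (q, r) determines p, so columns have disjoint supports. Slice p has
weight (b - p) + (p + 1) = b + 1 for every p. -/
theorem marginalSpectrum_polyMul_first (h01 : i₀ ≠ i₁) (h02 : i₀ ≠ i₂) (h12 : i₁ ≠ i₂)
    (hd0 : d i₀ = b) (hd1 : d i₁ = b + 1) (hd2 : d i₂ = 2)
    (hd : ∀ i, i ≠ i₀ → i ≠ i₁ → i ≠ i₂ → d i = 1)
    (hT : ∀ y, T y = (polyMulCoeff b (y i₀) (y i₁) (y i₂) : ℂ)) {m : ℕ} (hm : m < b) :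
    marginalSpectrum T i₀ m = (b : ℝ)⁻¹ := by
  have key : (flattening T i₀)ᴴ * flattening T i₀ = ((b + 1 : ℝ) : ℂ) • 1 := by
    refine conjTranspose_mul_self_flattening_eq_smul_one (fun r a a' ha ha' => ?_) fun a => ?_
    · simp only [flattening, Matrix.of_apply, hT, ne_eq, Complex.ofReal_eq_zero,
        Equiv.piSplitAt_symm_apply, dite_true, h01.symm, h02.symm, dite_false] at ha ha'
      have h1 := eq_add_of_polyMulCoeff_ne_zero ha
      have h2 := eq_add_of_polyMulCoeff_ne_zero ha'
      exact Fin.ext (by omega)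
    · have ha : (a : ℕ) < b := lt_of_lt_of_eq a.2 hd0
      have := sum_eq_sum_three h01 h02 h12 hd
        (fun p q r => if p = a then polyMulCoeff b p q r ^ 2 else 0)
      simp only [Fin.ext_iff, hT, Complex.norm_real, Real.norm_eq_abs, sq_abs]
      rw [this]
      clear this
      generalize (a : ℕ) = a at ha ⊢
      rw [hd0, hd1, hd2, Finset.sum_eq_single a (fun p _ hp => by simp [hp])
        (fun h => absurd (Finset.mem_range.mpr ha) h), Finset.sum_comm]
      simp only [sq_polyMulCoeff ha.le, if_true, Finset.sum_ite_eq', Finset.sum_range_succ _ 1,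
        Finset.sum_range_one, Finset.mem_range]
      rw [if_pos (by omega), if_pos (by omega), if_neg one_ne_zero]
      ring
  have hz : ((b + 1 : ℝ) : ℂ) ≠ 0 := by exact_mod_cast (Nat.succ_ne_zero b)
  rw [marginalSpectrum_eq_inv_card hz key (by simpa [hd0] using hm), Fintype.card_fin, hd0]

/-- Likewise (p, r) determines q, and slice q has weight b - q from r = 0 plus q from r = 1, in
total b. -/
theorem marginalSpectrum_polyMul_second (h01 : i₀ ≠ i₁) (h02 : i₀ ≠ i₂) (h12 : i₁ ≠ i₂)
    (hb : 0 < b) (hd0 : d i₀ = b) (hd1 : d i₁ = b + 1) (hd2 : d i₂ = 2)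
    (hd : ∀ i, i ≠ i₀ → i ≠ i₁ → i ≠ i₂ → d i = 1)
    (hT : ∀ y, T y = (polyMulCoeff b (y i₀) (y i₁) (y i₂) : ℂ)) {m : ℕ} (hm : m < b + 1) :
    marginalSpectrum T i₁ m = ((b + 1 : ℕ) : ℝ)⁻¹ := by
  have key : (flattening T i₁)ᴴ * flattening T i₁ = ((b : ℝ) : ℂ) • 1 := by
    refine conjTranspose_mul_self_flattening_eq_smul_one (fun r a a' ha ha' => ?_) fun a => ?_
    · simp only [flattening, Matrix.of_apply, hT, ne_eq, Complex.ofReal_eq_zero,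
        Equiv.piSplitAt_symm_apply, dite_true, h01, h12.symm, dite_false] at ha ha'
      have h1 := eq_add_of_polyMulCoeff_ne_zero ha
      have h2 := eq_add_of_polyMulCoeff_ne_zero ha'
      exact Fin.ext (by omega)
    · have ha : (a : ℕ) < b + 1 := lt_of_lt_of_eq a.2 hd1
      have := sum_eq_sum_three h01 h02 h12 hd
        (fun p q r => if q = a then polyMulCoeff b p q r ^ 2 else 0)
      simp only [Fin.ext_iff, hT, Complex.norm_real, Real.norm_eq_abs, sq_abs]
      rw [this]
      clear this
      generalize (a : ℕ) = a at ha ⊢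
      rw [hd0, hd1, hd2, Finset.sum_comm, Finset.sum_eq_single a
        (fun p _ hp => by simp [hp]) (fun h => absurd (Finset.mem_range.mpr ha) h),
        Finset.sum_comm]
      simp only [if_true, Finset.sum_range_succ _ 1, Finset.sum_range_one]
      have h0 : ∑ p ∈ Finset.range b, polyMulCoeff b p a 0 ^ 2 = b - (a : ℝ) := by
        rw [Finset.sum_congr rfl fun p hp =>
          sq_polyMulCoeff (q := a) (r := 0) (Finset.mem_range.mp hp).le]
        simp only [add_zero, if_true, Finset.sum_ite_eq, Finset.mem_range]
        split_ifs with h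
        · rfl
        -- The term p = b is outside the range, but its weight b - a would be zero.
        · have : a = b := by omega
          simp [this]
      have h1 : ∑ p ∈ Finset.range b, polyMulCoeff b p a 1 ^ 2 = a := by
        rw [Finset.sum_congr rfl fun p hp =>
          sq_polyMulCoeff (q := a) (r := 1) (Finset.mem_range.mp hp).le]
        rcases Nat.eq_zero_or_eq_succ_pred a with h | h
        · rw [h]; simp
        · rw [h]
          simp only [Nat.succ_eq_add_one, add_left_inj, one_ne_zero, if_false, Finset.sum_ite_eq,
            Finset.mem_range]
          rw [if_pos (by omega)]
          push_cast
          rfl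
      rw [h0, h1]
      ring
  have hz : ((b : ℝ) : ℂ) ≠ 0 := by exact_mod_cast hb.ne'
  rw [marginalSpectrum_eq_inv_card hz key (by simpa [hd1] using hm), Fintype.card_fin, hd1]

theorem polyMul_ne_zero (hb : 0 < b)
    (hd : ∀ i, 0 < d i)
    (hT : ∀ y, T y = (polyMulCoeff b (y i₀) (y i₁) (y i₂) : ℂ)) : T ≠ 0 := by
  refine Function.ne_iff.mpr ⟨fun i => ⟨0, hd i⟩, ?_⟩
  rw [hT]
  have : (0 : ℝ) < b := by exact_mod_cast hb
  simpa [polyMulCoeff] using this.ne'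

end Construction

end TensorNetwork

/-! ### Stability of the obstruction and conclusion -/

namespace TensorNetwork

theorem marginalSpectrum_le_zero {k : ℕ} {ι : Fin k → Type} [∀ i, Fintype (ι i)]
    [∀ i, DecidableEq (ι i)] (T : Tensor ι) (i : Fin k) {m : ℕ} (hm : m < Fintype.card (ι i)) :
    marginalSpectrum T i m ≤ marginalSpectrum T i 0 := by
  rw [marginalSpectrum, marginalSpectrum, dif_pos hm, dif_pos (Nat.zero_lt_of_lt hm)]
  exact (marginal_isHermitian T i).eigenvalues₀_antitone (Fin.mk_le_mk.mpr (Nat.zero_le m))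

/-- The marginal spectra of a matrix product state of bond dimension `n` cannot be close to flat
spectra of two different ranks `b < c` at two neighbouring parties, rank two at the next one and
rank one at all others, if `n ^ 2 - n < b`. -/
theorem IsPeriodicMPS.inv_sub_inv_le {k n b c : ℕ} {ι : Fin k → Type} [∀ i, Fintype (ι i)]
    [∀ i, DecidableEq (ι i)] {T : Tensor ι} (hT0 : T ≠ 0) (hT : IsPeriodicMPS n T)
    (hn : 0 < n) (hb : n ^ 2 - n < b)
    {i₀ i₁ i₂ : Fin k} (h01 : i₀ ≠ i₁) (h02 : i₀ ≠ i₂) (h21 : i₂ ≠ i₁)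
    (hr0 : finRotate k i₀ = i₁) (hr1 : finRotate k i₁ = i₂) {p : Fin k → ℕ → ℝ}
    (hp0 : ∀ m < b, p i₀ m = (b : ℝ)⁻¹) (hp1 : p i₁ 0 = (c : ℝ)⁻¹) (hp2 : p i₂ 0 + p i₂ 1 = 1)
    (hp : ∀ i, i ≠ i₀ → i ≠ i₁ → i ≠ i₂ → p i 0 = 1) {ε : ℝ} (hε0 : 0 < ε) (hε : ε < (b : ℝ)⁻¹)
    (hclose : ∀ i m, |marginalSpectrum T i m - p i m| < ε) :
    (b : ℝ)⁻¹ - (c : ℝ)⁻¹ ≤ (2 * k + 2) * ε := by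
  obtain ⟨A, t, ht, hdiag⟩ := exists_applyLocal_diagonal hT0
  choose σ hσ using exists_equiv_eigenvalues_eq T
  obtain ⟨y, -⟩ := Function.ne_iff.mp hT0
  have hN : ∀ i, 0 < Fintype.card (ι i) := fun i => Fintype.card_pos_iff.mpr ⟨y i⟩
  have hlow : ∀ i m, p i m - ε < marginalSpectrum T i m := fun i m => by
    have := (abs_lt.mp (hclose i m)).1; linarith
  have hupp : ∀ i m, marginalSpectrum T i m < p i m + ε := fun i m => by
    have := (abs_lt.mp (hclose i m)).2; linarith
  -- Since ε < 1/b, the first b eigenvalues at `i₀` cannot be padding zeros.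
  have hbN : b ≤ Fintype.card (ι i₀) := by
    by_contra! hlt
    have h1 := hlow i₀ (b - 1)
    rw [marginalSpectrum_eq_zero T i₀ (by omega), hp0 _ (by omega)] at h1
    linarith
  let base : ∀ i, ι i := fun i => σ i ⟨0, hN i⟩
  let e₁ : ι i₂ := if h : 1 < Fintype.card (ι i₂) then σ i₂ ⟨1, h⟩ else base i₂
  let S : Finset (ι i₀) := Finset.univ.map ((Fin.castLEEmb hbN).trans (σ i₀).toEmbedding)
  let rk : Fin k → ℕ := fun i => if i = i₂ then 2 else 1
  let E : ∀ i, Finset (ι i) := fun i => {a | ((σ i).symm a : ℕ) < rk i}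
  have hβ0 : 0 ≤ t * ((c : ℝ)⁻¹ + ε) := by positivity
  have main := (hT.map_applyLocal A).le_add_sum_tail hn h01 h02 h21 hr0 hr1 hdiag
    (α := t * ((b : ℝ)⁻¹ - ε)) (β := t * ((c : ℝ)⁻¹ + ε)) hβ0 ?_ base (base i₂) e₁ S ?_ ?_ E ?_ ?_
  -- The kept eigenvalues miss total mass 1 by at most 2ε at `i₂` and ε at each further party. With
  -- at most k tails and one ε each from α and β, the constant is 2k + 2.
  · have htail : ∀ i ∈ (Finset.univ.filter fun i => i ≠ i₀ ∧ i ≠ i₁),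
        ∑ a ∈ (E i)ᶜ, t * (marginal_isHermitian T i).eigenvalues a ≤ t * (2 * ε) := by
      intro i hi
      obtain ⟨-, hi0, hi1⟩ := Finset.mem_filter.mp hi
      rw [← Finset.mul_sum]
      refine mul_le_mul_of_nonneg_left ?_ ht.le
      have h1 := Finset.sum_add_sum_compl (E i) (marginal_isHermitian T i).eigenvalues
      rw [sum_eigenvalues_marginal hT0, sum_eigenvalues_filter_lt T i (hσ i) (rk i)] at h1
      by_cases hi2 : i = i₂
      · subst hi2
        simp only [rk, if_true, Finset.sum_range_succ, Finset.sum_range_zero, zero_add] at h1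
        have := hlow i 0
        have := hlow i 1
        linarith
      · simp only [rk, if_neg hi2, Finset.sum_range_one] at h1
        have := hlow i 0
        rw [hp i hi0 hi1 hi2] at this
        linarith
    have hsum := Finset.sum_le_card_nsmul _ _ _ htail
    have hcard : ((Finset.univ.filter fun i : Fin k => i ≠ i₀ ∧ i ≠ i₁).card : ℝ) ≤ k := by
      exact_mod_cast (Finset.card_filter_le _ _).trans (by simp)
    rw [nsmul_eq_mul] at hsum
    have h2 : ((Finset.univ.filter fun i : Fin k => i ≠ i₀ ∧ i ≠ i₁).card : ℝ) * (t * (2 * ε))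
        ≤ k * (t * (2 * ε)) := by gcongr
    have h3 : t * ((b : ℝ)⁻¹ - (c : ℝ)⁻¹) ≤ t * ((2 * k + 2) * ε) := by
      linarith [main.trans (add_le_add_right (hsum.trans h2) _)]
    exact le_of_mul_le_mul_left h3 ht
  · intro a
    refine mul_le_mul_of_nonneg_left ?_ ht.le
    rw [← (σ i₁).apply_symm_apply a, hσ]
    have := hupp i₁ 0
    rw [hp1] at this
    exact (marginalSpectrum_le_zero T i₁ ((σ i₁).symm a).2).trans this.le
  · simpa [S] using hb
  · intro a ha
    obtain ⟨m, -, rfl⟩ := Finset.mem_map.mp ha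
    refine mul_le_mul_of_nonneg_left ?_ ht.le
    have h1 := hlow i₀ m
    rw [hp0 m m.2] at h1
    have h2 := hσ i₀ (Fin.castLE hbN m)
    exact h1.le.trans (le_of_eq h2.symm)
  · intro a ha
    have ha : ((σ i₂).symm a : ℕ) < 2 := by simpa [E, rk] using ha
    rw [Finset.mem_insert, Finset.mem_singleton]
    obtain h | h : ((σ i₂).symm a : ℕ) = 0 ∨ ((σ i₂).symm a : ℕ) = 1 := by omega
    · left
      exact (Equiv.symm_apply_eq _).mp (Fin.ext h)
    · right
      have h1 : 1 < Fintype.card (ι i₂) := h ▸ ((σ i₂).symm a).2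
      simp only [e₁, dif_pos h1]
      exact (Equiv.symm_apply_eq _).mp (Fin.ext h)
  · intro i _ _ hi2 a ha
    have ha : ((σ i).symm a : ℕ) < 1 := by simpa [E, rk, hi2] using ha
    exact Finset.mem_singleton.mpr ((Equiv.symm_apply_eq _).mp (Fin.ext (by simpa using ha)))

end TensorNetwork

theorem corollary1p5 (k n c : ℕ) (hk : 3 ≤ k) (hc : n ^ 2 - n + 1 < c) (hc' : c ≤ n ^ 2) :
    ∃ p : Fin k → ℕ → ℝ,
      (∃ (d : Fin k → ℕ) (A : ∀ i, Matrix (Fin (d i)) (Fin c) ℂ),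
        TensorNetwork.applyLocal A (TensorNetwork.ghz c k) ≠ 0 ∧
        ∀ i, TensorNetwork.marginalSpectrum
          (TensorNetwork.applyLocal A (TensorNetwork.ghz c k)) i = p i) ∧
      ∃ ε : ℝ, 0 < ε ∧
        ∀ (d : Fin k → ℕ) (T : TensorNetwork.Tensor (fun i => Fin (d i))),
          T ≠ 0 → TensorNetwork.IsPeriodicMPS n T →
          ∃ (i : Fin k) (m : ℕ), ε ≤ |TensorNetwork.marginalSpectrum T i m - p i m| := by
  open TensorNetwork in
  have hn : 0 < n := by
    rcases Nat.eq_zero_or_pos n with rfl | h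
    · simp at hc hc'; omega
    · exact h
  obtain ⟨b, rfl⟩ : ∃ b, c = b + 1 := ⟨c - 1, by omega⟩
  have hb : n ^ 2 - n < b := by omega
  have hb0 : 0 < b := by omega
  obtain ⟨k, rfl⟩ : ∃ j, k = j + 3 := ⟨k - 3, by omega⟩
  obtain ⟨i₀, i₁, i₂, h01, h02, h12, hr0, hr1⟩ : ∃ i₀ i₁ i₂ : Fin (k + 3), i₀ ≠ i₁ ∧ i₀ ≠ i₂ ∧
      i₁ ≠ i₂ ∧ finRotate (k + 3) i₀ = i₁ ∧ finRotate (k + 3) i₁ = i₂ := by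
    refine ⟨⟨0, by omega⟩, ⟨1, by omega⟩, ⟨2, by omega⟩, by simp, by simp, by simp, ?_, ?_⟩
    · exact finRotate_of_lt (by omega)
    · exact finRotate_of_lt (by omega)
  let d : Fin (k + 3) → ℕ := fun i =>
    if i = i₀ then b else if i = i₁ then b + 1 else if i = i₂ then 2 else 1
  have hd0 : d i₀ = b := if_pos rfl
  have hd1 : d i₁ = b + 1 := by simp [d, h01.symm]
  have hd2 : d i₂ = 2 := by simp [d, h02.symm, h12.symm]
  have hd : ∀ i, i ≠ i₀ → i ≠ i₁ → i ≠ i₂ → d i = 1 := fun i h0 h1 h2 => by simp [d, h0, h1, h2]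
  have hdpos : ∀ i, 0 < d i := fun i => by
    simp only [d]
    split_ifs <;> omega
  obtain ⟨A, hA⟩ := exists_applyLocal_ghz_eq h01 h02 h12 hd0 hd1 hd2
  have hS0 := polyMul_ne_zero hb0 hdpos hA
  -- The gap 1/b - 1/(b + 1) is 1/(b(b + 1)); dividing by one more than the constant 2(k + 3) + 2 of
  -- the stability bound makes the contradiction strict.
  refine ⟨marginalSpectrum (applyLocal A (ghz (b + 1) (k + 3))), ⟨d, A, hS0, fun i => rfl⟩,
    ((b : ℝ) * (b + 1) * (2 * (k + 3) + 3))⁻¹, by positivity, fun d' T hT0 hT => ?_⟩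
  by_contra! hclose
  have hb1 : (0 : ℝ) < b := by exact_mod_cast hb0
  have hsum := fun i => sum_range_marginalSpectrum hS0 i
  simp only [Fintype.card_fin] at hsum
  have key := hT.inv_sub_inv_le (b := b) (c := b + 1) hT0 hn hb h01 h02 h12.symm hr0 hr1
    (fun m hm => marginalSpectrum_polyMul_first h01 h02 h12 hd0 hd1 hd2 hd hA hm)
    (marginalSpectrum_polyMul_second h01 h02 h12 hb0 hd0 hd1 hd2 hd hA (Nat.succ_pos b))
    (by simpa [hd2, Finset.sum_range_succ] using hsum i₂)
    (fun i h0 h1 h2 => by simpa [hd i h0 h1 h2] using hsum i)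
    (by positivity) ?_ hclose
  · have h1 : (b : ℝ)⁻¹ - ((b + 1 : ℕ) : ℝ)⁻¹ = ((b : ℝ) * (b + 1))⁻¹ := by
      push_cast
      field_simp
      ring
    rw [h1, mul_inv _ (2 * ((k : ℝ) + 3) + 3)] at key
    have h2 : (0 : ℝ) < ((b : ℝ) * (b + 1))⁻¹ := by positivity
    have h3 : (2 * ((k + 3 : ℕ) : ℝ) + 2) * (2 * ((k : ℝ) + 3) + 3)⁻¹ < 1 := by
      push_cast
      rw [← div_eq_mul_inv, div_lt_one (by positivity)]
      linarith
    nlinarith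
  · refine inv_strictAnti₀ hb1 ?_
    have hk0 : (0 : ℝ) ≤ k := Nat.cast_nonneg k
    nlinarith [mul_pos hb1 hb1, mul_nonneg (mul_pos hb1 hb1).le hk0, mul_nonneg hb1.le hk0]
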